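/- Let $\alpha,\beta,\gamma\in\mathbb{R}$ with $\alpha,\beta,\gamma>-1$ and $|\alpha-\beta|<1$. For $n,m\in\mathbb{N}_0$ put $$B_{(n,m)}(x)=N_{n,m}\sum_{k=0}^{n}\sum_{j=0}^{m}B_{n,m}^{k,j}\,(x-1)^{j+k}x^{n+m-j-k},\qquad N_{n,m}=\Big(\sum_{k=0}^{n}\sum_{j=0}^{m}B_{n,m}^{k,j}\Big)^{-1},$$ $$B_{n,m}^{k,j}=\frac{(\gamma+j+k+1)_{m-j}\,(\gamma+k+m+1)_{n-k}\,(\alpha-k+n+1)_{k}\,(\beta-j-k+m+n+1)_{j}}{j!\,k!\,(m-j)!\,(n-k)!},$$ where $(z)_k=z(z+1)\cdots(z+k-1)$, and let $B^{(2n)}=B_{(n,n)}$, $B^{(2n+1)}=B_{(n+1,n)}$ (the type II Jacobi–Piñeiro polynomials on the step-line). Write $B^{(l)}(x)=\sum_{i}S_{l,i}x^i$, let $\Lambda$ be the semi-infinite shift matrix ($\Lambda_{k,k+1}=1$, all other entries $0$), and let $J=S\Lambda S^{-1}$ be the Jacobi matrix. Then: 1. For every $l\in\mathbb{N}_0$,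 $B^{(l)}$ is a monic type II multiple orthogonal polynomial for the weights $w_1(x)=x^\alpha$, $w_2(x)=x^\beta$ and the measure $d\mu(x)=(1-x)^\gamma dx$ on $[0,1]$, with multi-index $(\nu_1,\nu_2)=(\lceil l/2\rceil,\lfloor l/2\rfloor)$: it is monic of degree $l$, and for $a=1,2$ and $0\le j<\nu_a$ the function $B^{(l)}w_a x^j$ is $\mu$-integrable with $\int_0^1 B^{(l)}(x)\,w_a(x)\,x^j\,d\mu(x)=0$. 2. $J$ is the matrix of the recurrence relation: $xB^{(l)}(x)=\sum_{m=0}^{l+1}J_{l,m}B^{(m)}(x)$ for all $l\in\mathbb{N}_0$. It is four-diagonal: $J_{l,l+1}=1$, and $J_{l,m}=0$ whenever $m>l+1$ or $m<l-2$. 3. $J$ is a nonnegative matrix: $J_{l,m}\ge 0$ for all $l,m\in\mathbb{N}_0$. -/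

import Mathlib

open MeasureTheory Polynomial

noncomputable section

namespace JacobiPineiro

/-- The Pochhammer symbol `(z)_k = z (z + 1) ⋯ (z + k - 1)`. -/
def poch (z : ℝ) (k : ℕ) : ℝ := (ascPochhammer ℝ k).eval z

/-- `P` is a monic type II multiple orthogonal polynomial with multi-index `ν` for the system of
weights `w` and the measure `μ`: it is monic of degree `|ν|` and
`∫ P(x) w_a(x) x^j dμ(x) = 0` for every `a` and every `j < ν_a`
(the integrands being integrable). -/
structure IsMonicTypeII {p : ℕ} (μ : Measure ℝ) (w : Fin p → ℝ → ℝ) (ν : Fin p → ℕ)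
    (P : ℝ[X]) : Prop where
  monic : P.Monic
  natDegree_eq : P.natDegree = ∑ a, ν a
  integrable : ∀ a, ∀ j < ν a, Integrable (fun x => P.eval x * w a x * x ^ j) μ
  orthogonal : ∀ a, ∀ j < ν a, ∫ x, P.eval x * w a x * x ^ j ∂μ = 0

/-- The measure `(1 - x)^γ dx` on `[0, 1]`. -/
def measure (γ : ℝ) : Measure ℝ :=
  (volume.restrict (Set.Icc 0 1)).withDensity fun x => ENNReal.ofReal ((1 - x) ^ γ)

/-- The two weights `x^α` and `x^β`. -/
def weight (α β : ℝ) : Fin 2 → ℝ → ℝ := ![fun x => x ^ α, fun x => x ^ β]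

/-- The step-line multi-indices `(0,0), (1,0), (1,1), (2,1), (2,2), …`. -/
def stepLine (l : ℕ) : Fin 2 → ℕ := ![(l + 1) / 2, l / 2]

/-- The coefficient `B_{n,m}^{k,j}`, for `k ≤ n` and `j ≤ m`. -/
def typeIICoeff (α β γ : ℝ) (n m k j : ℕ) : ℝ :=
  poch (γ + j + k + 1) (m - j) * poch (γ + k + m + 1) (n - k) *
      poch (α - k + n + 1) k * poch (β - j - k + m + n + 1) j /
    (j.factorial * k.factorial * (m - j).factorial * (n - k).factorial)

/-- The normalization constant `N_{n,m}`, which makes the polynomial monic. -/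
def normalization (α β γ : ℝ) (n m : ℕ) : ℝ :=
  1 / ∑ k ∈ Finset.range (n + 1), ∑ j ∈ Finset.range (m + 1), typeIICoeff α β γ n m k j

/-- The type II Jacobi-Piñeiro polynomial
`B_{(n,m)} = N_{n,m} ∑_{k ≤ n} ∑_{j ≤ m} B_{n,m}^{k,j} (x - 1)^{j+k} x^{n+m-j-k}`. -/
def typeII (α β γ : ℝ) (n m : ℕ) : ℝ[X] :=
  C (normalization α β γ n m) *
    ∑ k ∈ Finset.range (n + 1), ∑ j ∈ Finset.range (m + 1),
      C (typeIICoeff α β γ n m k j) * (X - 1) ^ (j + k) * X ^ (n + m - j - k)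

/-- The step-line sequence `B^{(2n)} = B_{(n,n)}`, `B^{(2n+1)} = B_{(n+1,n)}`. -/
def typeIISeq (α β γ : ℝ) (l : ℕ) : ℝ[X] :=
  typeII α β γ (stepLine l 0) (stepLine l 1)

/-- The inverse of a lower unitriangular semi-infinite matrix `S`, by forward substitution:
row `l` is determined by the rows above it. -/
def lowerInv (S : Matrix ℕ ℕ ℝ) (l i : ℕ) : ℝ :=
  if l < i then 0 else if l = i then 1 else
    -∑ k : Fin l, S l k * lowerInv S k i
termination_by l

/-- The matrix `S` of coefficients of a sequence of polynomials: `B^{(l)} = ∑_i S_{l,i} x^i`. -/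
def coeffMatrix (B : ℕ → ℝ[X]) : Matrix ℕ ℕ ℝ := fun l i => (B l).coeff i

/-- The Jacobi matrix `J = S Λ S⁻¹` of a sequence of monic polynomials with `deg B^{(l)} = l`,
where `Λ` is the shift matrix (`Λ_{k,k+1} = 1`, all other entries `0`) and `S` is the matrix of
coefficients: `J_{l,m} = ∑_{k ≤ l} S_{l,k} (S⁻¹)_{k+1,m}`. -/
def jacobiMatrix (B : ℕ → ℝ[X]) : Matrix ℕ ℕ ℝ := fun l m =>
  ∑ k ∈ Finset.range (l + 1), coeffMatrix B l k * lowerInv (coeffMatrix B) (k + 1) m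

end JacobiPineiro

end

namespace JacobiPineiro

/-! ### Pochhammer symbols -/

/-! Up to a constant, each polynomial is a double Rodrigues expression (`rodriguesTypeII`).
Integration by parts therefore gives its moments against x^s (1-x)^γ in closed form
(`moment_typeII`): a constant times (α-s)_n (β-s)_m times the Beta integral ∫ x^s (1-x)^(γ+n+m).
Orthogonality is the vanishing of a Pochhammer factor at s = α+j or s = β+j. Moments determine a
polynomial (`eq_of_moment_eq`). A linear relation between such polynomials can thus be checked on
moments, where the common Pochhammer factors cancel and only the contiguous relations of the Beta
integral remain. Two relations are needed. `typeIISeq_connection` passes from parameters (α,β) to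
(β,α+1); applied twice it reaches (α+1,β+1), so B = L B̃ with B̃ the sequence for (α+1,β+1) and L
unitriangular with two subdiagonals. `typeIISeq_christoffel` gives x B̃ = U B with U upper
bidiagonal. Hence J = L U is four-diagonal, and it is nonnegative because L and U are. The delicate
point is the first connection coefficient of index 0, which is negative when α > β. It would enter
only row 1 of L, and there B^{(1)} does not involve β, so another path of parameters is available
(`typeIISeq_connection_one`). -/

@[simp] lemma poch_zero (z : ℝ) : poch z 0 = 1 := by simp [poch]

lemma poch_succ_right (z : ℝ) (k : ℕ) : poch z (k + 1) = poch z k * (z + k) :=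
  ascPochhammer_succ_eval k z

lemma poch_succ_left (z : ℝ) (k : ℕ) : poch z (k + 1) = z * poch (z + 1) k := by
  simp [poch, ascPochhammer_succ_left]

/-- Positivity of z is asked only when k > 0: for n = m = 0 the argument α+γ+1 in `leadConst` may be
negative. -/
lemma poch_pos {z : ℝ} {k : ℕ} (h : 0 < k → 0 < z) : 0 < poch z k := by
  rcases Nat.eq_zero_or_pos k with rfl | hk
  · simp
  · exact ascPochhammer_pos k z (h hk)

lemma poch_neg_natCast {m j : ℕ} (h : j < m) : poch (-(j : ℝ)) m = 0 := by
  obtain ⟨i, rfl⟩ := Nat.exists_eq_add_of_lt h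
  induction i with
  | zero => rw [add_zero, poch_succ_right]; simp
  | succ i ih => rw [← add_assoc, poch_succ_right, ih (by omega), zero_mul]

/-! ### The Rodrigues operators -/

/-- The raising operator `P ↦ x^{-a} (1 - x)^{-c} (x^{a+1} (1 - x)^{c+1} P)'`. -/
noncomputable def raise (a c : ℝ) (P : ℝ[X]) : ℝ[X] :=
  C (a + 1) * ((1 - X) * P) - C (c + 1) * (X * P) + X * (1 - X) * derivative P

/-- The operator `P ↦ x^{-a} (1 - x)^{-c} (x^{a+m} (1 - x)^{c+m} P)^{(m)}`. -/
noncomputable def rodrigues (a c : ℝ) : ℕ → ℝ[X] → ℝ[X]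
  | 0, P => P
  | m + 1, P => rodrigues a c m (raise (a + m) (c + m) P)

lemma raise_add (a c : ℝ) (P Q : ℝ[X]) : raise a c (P + Q) = raise a c P + raise a c Q := by
  simp only [raise, derivative_add]; ring

lemma raise_C_mul (a c r : ℝ) (P : ℝ[X]) : raise a c (C r * P) = C r * raise a c P := by
  simp only [raise, derivative_C_mul]; ring

lemma rodrigues_add (a c : ℝ) (m : ℕ) (P Q : ℝ[X]) :
    rodrigues a c m (P + Q) = rodrigues a c m P + rodrigues a c m Q := by
  induction m generalizing P Q with
  | zero => rfl
  | succ m ih => simp only [rodrigues, raise_add, ih]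

lemma rodrigues_C_mul (a c r : ℝ) (m : ℕ) (P : ℝ[X]) :
    rodrigues a c m (C r * P) = C r * rodrigues a c m P := by
  induction m generalizing P with
  | zero => rfl
  | succ m ih => simp only [rodrigues, raise_C_mul, ih]

lemma rodrigues_sum {ι : Type*} (a c : ℝ) (m : ℕ) (t : Finset ι) (f : ι → ℝ[X]) :
    rodrigues a c m (∑ i ∈ t, f i) = ∑ i ∈ t, rodrigues a c m (f i) :=
  map_sum (AddMonoidHom.mk' (rodrigues a c m) (rodrigues_add a c m)) f t

lemma raise_monomial (a c : ℝ) (p q : ℕ) :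
    raise a c (X ^ p * (1 - X) ^ q) = C (a + 1 + p) * (X ^ p * (1 - X) ^ (q + 1)) -
      C (c + 1 + q) * (X ^ (p + 1) * (1 - X) ^ q) := by
  rcases p with _ | p <;> rcases q with _ | q <;>
  simp [raise, derivative_mul, derivative_pow] <;> ring

/-- The Leibniz rule for the iterated raising operator. -/
lemma rodrigues_monomial (a c : ℝ) (m p q : ℕ) :
    rodrigues a c m (X ^ p * (1 - X) ^ q) = ∑ ij ∈ Finset.HasAntidiagonal.antidiagonal m,
      (m.choose ij.1 : ℝ[X]) * (C ((-1) ^ ij.2 * poch (a + p + ij.2 + 1) ij.1 *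
        poch (c + q + ij.1 + 1) ij.2) * (X ^ (p + ij.2) * (1 - X) ^ (q + ij.1))) := by
  induction m generalizing p q with
  | zero => simp [rodrigues]
  | succ m ih =>
    -- Pascal's rule splits the sum in two, matching the two monomials produced by one raising step.
    rw [Finset.sum_antidiagonal_choose_succ_mul (fun j i : ℕ =>
      (C ((-1) ^ i * poch (a + p + i + 1) j *
        poch (c + q + j + 1) i) * (X ^ (p + i) * (1 - X) ^ (q + j)) : ℝ[X]))]
    rw [rodrigues, raise_monomial, sub_eq_add_neg, ← neg_mul, ← C_neg, rodrigues_add,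
      rodrigues_C_mul, rodrigues_C_mul, ih, ih, Finset.mul_sum, Finset.mul_sum, add_comm]
    refine congrArg₂ (· + ·) (Finset.sum_congr rfl ?_) (Finset.sum_congr rfl ?_) <;>
      rintro ⟨j, i⟩ hij <;>
      obtain rfl : j + i = m := by simpa using hij
    · have h : (-(c + ((j + i : ℕ) : ℝ) + 1 + q)) * ((-1) ^ i *
          poch (a + ((p + 1 : ℕ) : ℝ) + i + 1) j * poch (c + q + j + 1) i) =
          (-1) ^ (i + 1) * poch (a + p + ((i + 1 : ℕ) : ℝ) + 1) j *
            poch (c + q + j + 1) (i + 1) := by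
        rw [poch_succ_right]
        have : a + ((p + 1 : ℕ) : ℝ) + i + 1 = a + p + ((i + 1 : ℕ) : ℝ) + 1 := by
          push_cast; ring
        rw [this]; push_cast; ring
      simp only
      rw [← h, C_mul (a := -(c + ((j + i : ℕ) : ℝ) + 1 + q)), add_right_comm p 1 i, add_assoc p i 1]
      ring
    · have h : (a + ((j + i : ℕ) : ℝ) + 1 + p) * ((-1) ^ i *
          poch (a + p + i + 1) j * poch (c + ((q + 1 : ℕ) : ℝ) + j + 1) i) =
          (-1) ^ i * poch (a + p + i + 1) (j + 1) *
            poch (c + q + ((j + 1 : ℕ) : ℝ) + 1) i := by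
        rw [poch_succ_right]
        have : c + ((q + 1 : ℕ) : ℝ) + j + 1 = c + q + ((j + 1 : ℕ) : ℝ) + 1 := by
          push_cast; ring
        rw [this]; push_cast; ring
      have hc : (j + i).choose j = (j + i).choose i := by
        rw [Nat.choose_symm_add]
      simp only
      rw [← h, C_mul (a := a + ((j + i : ℕ) : ℝ) + 1 + p), hc, add_right_comm q 1 j, add_assoc q j 1]
      ring

/-! ### Degrees and leading coefficients -/

lemma raise_natDegree_le {a c : ℝ} {P : ℝ[X]} {d : ℕ} (h : P.natDegree ≤ d) :
    (raise a c P).natDegree ≤ d + 1 ∧ (raise a c P).coeff (d + 1) = -(a + c + 2 + d) * P.coeff d := by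
  have h1 : raise a c P = C (a + 1) * P - C (a + c + 2) * (P * X) + derivative P * X -
      derivative P * X * X := by
    simp only [raise, C_add, C_1, C_ofNat]; ring
  have hz : ∀ k, d < k → P.coeff k = 0 := fun k hk =>
    coeff_eq_zero_of_natDegree_lt (h.trans_lt hk)
  rw [h1]
  generalize hu : a + 1 = u
  generalize hv : a + c + 2 = v
  constructor
  · rw [natDegree_le_iff_coeff_eq_zero]
    intro k hk
    obtain ⟨e, rfl⟩ := Nat.exists_eq_add_of_le' (show 2 ≤ k by omega)
    simp [coeff_derivative, hz _ (show d < e + 1 by omega), hz _ (show d < e + 2 by omega)]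
  · rcases d with _ | d
    · simp [coeff_derivative, hz]
    · simp [coeff_derivative, hz]
      ring

lemma rodrigues_natDegree_le {a c : ℝ} {P : ℝ[X]} {d : ℕ} (m : ℕ) (h : P.natDegree ≤ d) :
    (rodrigues a c m P).natDegree ≤ d + m ∧
      (rodrigues a c m P).coeff (d + m) = (-1) ^ m * poch (a + c + d + m + 1) m * P.coeff d := by
  induction m generalizing P d with
  | zero => simpa [rodrigues] using h
  | succ m ih =>
    obtain ⟨h1, h2⟩ := raise_natDegree_le (a := a + m) (c := c + m) h
    obtain ⟨h3, h4⟩ := ih h1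
    have e : d + (m + 1) = d + 1 + m := by ring
    refine ⟨by rw [rodrigues, e]; exact h3, ?_⟩
    rw [rodrigues, e, h4, h2, poch_succ_right]
    have : a + c + ((d + 1 : ℕ) : ℝ) + m + 1 = a + c + d + ((m + 1 : ℕ) : ℝ) + 1 := by
      push_cast; ring
    rw [this]; push_cast; ring

/-! ### The Rodrigues formula for the type II polynomials -/

/-- The double Rodrigues formula, without normalization. -/
noncomputable def rodriguesTypeII (α β γ : ℝ) (n m : ℕ) : ℝ[X] :=
  rodrigues β γ m (rodrigues α (γ + m) n 1)

/-- The leading coefficient of `rodriguesTypeII`, up to sign. -/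
noncomputable def leadConst (α β γ : ℝ) (n m : ℕ) : ℝ :=
  poch (α + γ + (n + m : ℕ) + 1) n * poch (β + γ + (n + m : ℕ) + 1) m

lemma rodriguesTypeII_natDegree_le (α β γ : ℝ) (n m : ℕ) :
    (rodriguesTypeII α β γ n m).natDegree ≤ n + m ∧
      (rodriguesTypeII α β γ n m).coeff (n + m) = (-1) ^ (n + m) * leadConst α β γ n m := by
  obtain ⟨h1, h2⟩ := rodrigues_natDegree_le (a := α) (c := γ + m) n (natDegree_one (R := ℝ)).le
  rw [zero_add] at h1 h2
  obtain ⟨h3, h4⟩ := rodrigues_natDegree_le (a := β) (c := γ) m h1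
  refine ⟨h3, ?_⟩
  rw [rodriguesTypeII, h4, h2, leadConst]
  have e1 : α + (γ + m) + (0 : ℕ) + n + 1 = α + γ + (n + m : ℕ) + 1 := by push_cast; ring
  have e2 : β + γ + n + m + 1 = β + γ + (n + m : ℕ) + 1 := by push_cast; ring
  rw [e1, e2, coeff_one_zero]; ring

lemma rodriguesTypeII_eq_sum (α β γ : ℝ) (n m : ℕ) :
    rodriguesTypeII α β γ n m = C ((-1 : ℝ) ^ (n + m) * n.factorial * m.factorial) *
      ∑ k ∈ Finset.range (n + 1), ∑ j ∈ Finset.range (m + 1),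
        C (typeIICoeff α β γ n m k j) * (X - 1) ^ (j + k) * X ^ (n + m - j - k) := by
  have h := rodrigues_monomial α (γ + m) n 0 0
  -- The inner operator acts on 1 = X^0 (1-X)^0, so the Leibniz rule applies once inside and once
  -- outside.
  rw [pow_zero, pow_zero, mul_one] at h
  rw [rodriguesTypeII, h, rodrigues_sum, Finset.mul_sum,
    Finset.Nat.sum_antidiagonal_eq_sum_range_succ_mk]
  refine Finset.sum_congr rfl fun k hk => ?_
  obtain ⟨i, rfl⟩ := Nat.exists_eq_add_of_le (Nat.lt_succ_iff.1 (Finset.mem_range.1 hk))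
  simp only [Nat.add_sub_cancel_left, ← C_eq_natCast]
  rw [rodrigues_C_mul, rodrigues_C_mul, rodrigues_monomial, Finset.mul_sum, Finset.mul_sum,
    Finset.mul_sum, Finset.Nat.sum_antidiagonal_eq_sum_range_succ_mk]
  refine Finset.sum_congr rfl fun j hj => ?_
  obtain ⟨r, rfl⟩ := Nat.exists_eq_add_of_le (Nat.lt_succ_iff.1 (Finset.mem_range.1 hj))
  have e1 : k + i + (j + r) - j - k = i + r := by omega
  have e2 : (X - 1 : ℝ[X]) ^ (j + k) = C ((-1) ^ (j + k)) * (1 - X) ^ (j + k) := by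
    rw [C_pow, ← mul_pow]; congr 1; simp
  have e3 : (0 + k) + j = j + k := by ring
  have e4 : (0 + i) + r = i + r := by ring
  have a1 : α + (0 : ℕ) + i + 1 = α - k + (k + i : ℕ) + 1 := by push_cast; ring
  have a2 : γ + (j + r : ℕ) + (0 : ℕ) + k + 1 = γ + k + (j + r : ℕ) + 1 := by push_cast; ring
  have a3 : β + (0 + i : ℕ) + r + 1 = β - j - k + (j + r : ℕ) + (k + i : ℕ) + 1 := by
    push_cast; ring
  have a4 : γ + (0 + k : ℕ) + j + 1 = γ + j + k + 1 := by push_cast; ring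
  simp only [Nat.add_sub_cancel_left, typeIICoeff, ← C_eq_natCast]
  rw [e1, e2, e3, e4, a1, a2, a3, a4]
  have f1 := Nat.add_choose_mul_factorial_mul_factorial k i
  have f2 := Nat.add_choose_mul_factorial_mul_factorial j r
  have f1' : ((k + i).factorial : ℝ) = ((k + i).choose k : ℝ) * k.factorial * i.factorial := by
    rw [← f1, Nat.choose_symm_add]; push_cast; ring
  have f2' : ((j + r).factorial : ℝ) = ((j + r).choose j : ℝ) * j.factorial * r.factorial := by
    rw [← f2, Nat.choose_symm_add]; push_cast; ring
  rw [f1', f2']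
  generalize poch (α - k + (k + i : ℕ) + 1) k = A
  generalize poch (γ + k + (j + r : ℕ) + 1) i = B
  generalize poch (β - j - k + (j + r : ℕ) + (k + i : ℕ) + 1) j = D
  generalize poch (γ + j + k + 1) r = E
  have hs : ((-1 : ℝ) ^ (k + i + (j + r))) * (-1) ^ (j + k) = (-1) ^ i * (-1) ^ r := by
    have : ((-1 : ℝ) ^ j) * (-1) ^ j = 1 := by rw [← mul_pow]; norm_num
    have : ((-1 : ℝ) ^ k) * (-1) ^ k = 1 := by rw [← mul_pow]; norm_num
    simp only [pow_add]
    linear_combination ((-1 : ℝ) ^ k * (-1) ^ k * (-1) ^ i * (-1) ^ r) * ‹((-1 : ℝ) ^ j) * (-1) ^ j = 1› +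
      ((-1) ^ i * (-1) ^ r) * ‹((-1 : ℝ) ^ k) * (-1) ^ k = 1›
  have key : ((k + i).choose k : ℝ) * ((-1) ^ i * A * B * (((j + r).choose j : ℝ) *
      ((-1) ^ r * D * E))) =
      (-1) ^ (k + i + (j + r)) * (((k + i).choose k : ℝ) * k.factorial * i.factorial) *
        (((j + r).choose j : ℝ) * j.factorial * r.factorial) *
        (E * B * A * D / (j.factorial * k.factorial * r.factorial * i.factorial)) *
          (-1) ^ (j + k) := by
    have := Nat.factorial_ne_zero j
    have := Nat.factorial_ne_zero k
    have := Nat.factorial_ne_zero i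
    have := Nat.factorial_ne_zero r
    field_simp
    linear_combination -(((k + i).choose k : ℝ) * ((j + r).choose j : ℝ) * A * B * D * E) * hs
  have keyC := congrArg (C : ℝ → ℝ[X]) key
  simp only [C_mul] at keyC ⊢
  linear_combination ((1 - X) ^ (j + k) * X ^ (i + r) : ℝ[X]) * keyC

lemma leadConst_pos {α β γ : ℝ} (hα : -1 < α) (hβ : -1 < β) (hγ : -1 < γ) (n m : ℕ) :
    0 < leadConst α β γ n m := by
  refine mul_pos (poch_pos fun h => ?_) (poch_pos fun h => ?_)
  all_goals
    have : (1 : ℝ) ≤ (n + m : ℕ) := by exact_mod_cast (by omega : 1 ≤ n + m)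
    linarith

/-- The sum of the coefficients needs no direct evaluation: comparing leading coefficients on both
sides of `rodriguesTypeII_eq_sum` shows that it is `leadConst` divided by n! m!. -/
lemma typeII_eq {α β γ : ℝ} (hα : -1 < α) (hβ : -1 < β) (hγ : -1 < γ) (n m : ℕ) :
    typeII α β γ n m =
      C ((-1) ^ (n + m) / leadConst α β γ n m) * rodriguesTypeII α β γ n m := by
  have hD := (leadConst_pos hα hβ hγ n m).ne'
  have hsum := rodriguesTypeII_eq_sum α β γ n m
  obtain ⟨-, hc⟩ := rodriguesTypeII_natDegree_le α β γ n m
  have hcoef : (∑ k ∈ Finset.range (n + 1), ∑ j ∈ Finset.range (m + 1),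
        C (typeIICoeff α β γ n m k j) * (X - 1) ^ (j + k) * X ^ (n + m - j - k)).coeff (n + m) =
      ∑ k ∈ Finset.range (n + 1), ∑ j ∈ Finset.range (m + 1), typeIICoeff α β γ n m k j := by
    rw [finsetSum_coeff]
    refine Finset.sum_congr rfl fun k hk => ?_
    rw [finsetSum_coeff]
    refine Finset.sum_congr rfl fun j hj => ?_
    have hk' := Finset.mem_range.1 hk
    have hj' := Finset.mem_range.1 hj
    have hmon : ((X - 1 : ℝ[X]) ^ (j + k) * X ^ (n + m - j - k)).Monic :=
      (((monic_X_sub_C (1 : ℝ)).pow _)).mul (monic_X_pow _)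
    have hdeg : ((X - 1 : ℝ[X]) ^ (j + k) * X ^ (n + m - j - k)).natDegree = n + m := by
      rw [← C_1, Monic.natDegree_mul ((monic_X_sub_C (1 : ℝ)).pow _) (monic_X_pow _),
        natDegree_X_pow]
      have := natDegree_pow (X - C (1 : ℝ)) (j + k)
      rw [natDegree_X_sub_C] at this
      rw [this]; omega
    have := hmon.coeff_natDegree
    rw [hdeg] at this
    rw [mul_assoc, coeff_C_mul, this, mul_one]
  rw [hsum, coeff_C_mul, hcoef] at hc
  rw [typeII, hsum, normalization, ← mul_assoc, ← C_mul]
  congr 2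
  set T := ∑ k ∈ Finset.range (n + 1), ∑ j ∈ Finset.range (m + 1), typeIICoeff α β γ n m k j
  have hs : ((-1 : ℝ) ^ (n + m)) ≠ 0 := pow_ne_zero _ (by norm_num)
  have hs0 : T ≠ 0 := by
    rintro h0
    rw [h0, mul_zero] at hc
    exact mul_ne_zero hs hD hc.symm
  field_simp
  have hsq : ((-1 : ℝ) ^ (n + m)) * (-1) ^ (n + m) = 1 := by rw [← mul_pow]; norm_num
  linear_combination -(-1) ^ (n + m) * hc - leadConst α β γ n m * hsq

lemma typeII_monic {α β γ : ℝ} (hα : -1 < α) (hβ : -1 < β) (hγ : -1 < γ) (n m : ℕ) :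
    (typeII α β γ n m).Monic ∧ (typeII α β γ n m).natDegree = n + m := by
  have hD := (leadConst_pos hα hβ hγ n m).ne'
  obtain ⟨hd, hc⟩ := rodriguesTypeII_natDegree_le α β γ n m
  have h1 : (typeII α β γ n m).coeff (n + m) = 1 := by
    rw [typeII_eq hα hβ hγ, coeff_C_mul, hc]
    have : ((-1 : ℝ) ^ (n + m)) * (-1) ^ (n + m) = 1 := by rw [← mul_pow]; norm_num
    field_simp
    linear_combination this
  have h2 : (typeII α β γ n m).natDegree ≤ n + m := by
    rw [typeII_eq hα hβ hγ]; exact (natDegree_C_mul_le _ _).trans hd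
  have h3 : (typeII α β γ n m).natDegree = n + m :=
    le_antisymm h2 (le_natDegree_of_ne_zero (by rw [h1]; norm_num))
  exact ⟨by rw [Monic, leadingCoeff, h3, h1], h3⟩

/-! ### Moments with respect to the beta weight -/

/-- The moment `∫_0^1 P(x) x^s (1 - x)^c dx`. -/
noncomputable def moment (s c : ℝ) (P : ℝ[X]) : ℝ := ∫ x in (0 : ℝ)..1, P.eval x * (x ^ s * (1 - x) ^ c)

lemma intervalIntegrable_beta {s c : ℝ} (hs : -1 < s) (hc : -1 < c) :
    IntervalIntegrable (fun x : ℝ => x ^ s * (1 - x) ^ c) volume 0 1 := by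
  have h := Complex.betaIntegral_convergent (u := ((s + 1 : ℝ) : ℂ)) (v := ((c + 1 : ℝ) : ℂ))
    (by rw [Complex.ofReal_re]; linarith) (by rw [Complex.ofReal_re]; linarith)
  rw [intervalIntegrable_iff_integrableOn_Ioc_of_le zero_le_one] at h ⊢
  refine IntegrableOn.congr_fun h.re (fun x hx => ?_) measurableSet_Ioc
  have h1 : (((s + 1 : ℝ) : ℂ) - 1) = (s : ℝ) := by push_cast; ring
  have h2 : (((c + 1 : ℝ) : ℂ) - 1) = (c : ℝ) := by push_cast; ring
  have h3 : (1 - (x : ℂ)) = ((1 - x : ℝ) : ℂ) := by push_cast; ring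
  simp only [h1, h2, h3]
  rw [← Complex.ofReal_cpow hx.1.le, ← Complex.ofReal_cpow (by linarith [hx.2]),
    ← Complex.ofReal_mul]
  simp

lemma intervalIntegrable_eval_mul_beta {s c : ℝ} (hs : -1 < s) (hc : -1 < c) (P : ℝ[X]) :
    IntervalIntegrable (fun x : ℝ => P.eval x * (x ^ s * (1 - x) ^ c)) volume 0 1 :=
  (intervalIntegrable_beta hs hc).continuousOn_mul P.continuous.continuousOn

lemma moment_add {s c : ℝ} (hs : -1 < s) (hc : -1 < c) (P Q : ℝ[X]) :
    moment s c (P + Q) = moment s c P + moment s c Q := by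
  rw [moment, moment, moment, ← intervalIntegral.integral_add
    (intervalIntegrable_eval_mul_beta hs hc P) (intervalIntegrable_eval_mul_beta hs hc Q)]
  simp only [eval_add, add_mul]

lemma moment_C_mul (s c r : ℝ) (P : ℝ[X]) : moment s c (C r * P) = r * moment s c P := by
  rw [moment, moment, ← intervalIntegral.integral_const_mul]
  simp only [eval_mul, eval_C, mul_assoc]

lemma moment_sum {ι : Type*} {s c : ℝ} (hs : -1 < s) (hc : -1 < c) (t : Finset ι)
    (f : ι → ℝ[X]) : moment s c (∑ i ∈ t, f i) = ∑ i ∈ t, moment s c (f i) :=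
  map_sum (AddMonoidHom.mk' (moment s c) (moment_add hs hc)) f t

lemma integral_congr_Ioo {f g : ℝ → ℝ} (h : ∀ x, 0 < x → x < 1 → f x = g x) :
    ∫ x in (0 : ℝ)..1, f x = ∫ x in (0 : ℝ)..1, g x := by
  rw [intervalIntegral.integral_of_le zero_le_one, intervalIntegral.integral_of_le zero_le_one,
    integral_Ioc_eq_integral_Ioo, integral_Ioc_eq_integral_Ioo]
  exact setIntegral_congr_fun measurableSet_Ioo fun x hx => h x hx.1 hx.2

lemma moment_X_mul (s c : ℝ) (P : ℝ[X]) : moment s c (X * P) = moment (s + 1) c P := by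
  refine integral_congr_Ioo fun x h0 _ => ?_
  rw [eval_mul, eval_X, Real.rpow_add_one h0.ne']; ring

lemma moment_X_pow_mul (s c : ℝ) (j : ℕ) (P : ℝ[X]) :
    moment s c (X ^ j * P) = moment (s + j) c P := by
  induction j generalizing s with
  | zero => simp
  | succ j ih =>
    rw [pow_succ', mul_assoc, moment_X_mul, ih]; push_cast; congr 1; ring

lemma moment_one_sub_X_mul (s c : ℝ) (P : ℝ[X]) :
    moment s c ((1 - X) * P) = moment s (c + 1) P := by
  refine integral_congr_Ioo fun x _ h1 => ?_
  rw [eval_mul, eval_sub, eval_X, eval_one, Real.rpow_add_one (by linarith)]; ring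

/-- Integration by parts, with vanishing boundary terms. -/
lemma moment_raise_self {s c : ℝ} (hs : -1 < s) (hc : -1 < c) (P : ℝ[X]) :
    moment s c (raise s c P) = 0 := by
  have h := intervalIntegral.integral_eq_sub_of_hasDerivAt_of_le (zero_le_one (α := ℝ))
    (f := fun x : ℝ => P.eval x * (x ^ (s + 1) * (1 - x) ^ (c + 1)))
    (f' := fun x => (raise s c P).eval x * (x ^ s * (1 - x) ^ c))
    ?_ ?_ (intervalIntegrable_eval_mul_beta hs hc _)
  · rw [moment, h]
    simp [Real.zero_rpow (show s + 1 ≠ 0 by linarith), Real.zero_rpow (show c + 1 ≠ 0 by linarith)]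
  · refine P.continuous.continuousOn.mul (ContinuousOn.mul ?_ ?_)
    · exact ContinuousOn.rpow_const continuousOn_id fun x _ => Or.inr (by linarith)
    · exact ContinuousOn.rpow_const (by fun_prop) fun x _ => Or.inr (by linarith)
  · intro x hx
    have hx0 : x ≠ 0 := hx.1.ne'
    have hx1 : 1 - x ≠ 0 := by linarith [hx.2]
    have d1 : HasDerivAt (fun y : ℝ => y ^ (s + 1)) ((s + 1) * x ^ s) x := by
      simpa using Real.hasDerivAt_rpow_const (p := s + 1) (Or.inl hx0)
    have d2 : HasDerivAt (fun y : ℝ => (1 - y) ^ (c + 1)) (-((c + 1) * (1 - x) ^ c)) x := by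
      have := ((hasDerivAt_id x).const_sub 1).rpow_const (p := c + 1) (Or.inl hx1)
      refine this.congr_deriv ?_
      simp
      ring
    refine ((P.hasDerivAt x).mul (d1.mul d2)).congr_deriv ?_
    simp only [raise, eval_add, eval_sub, eval_mul, eval_C, eval_X, eval_one, Pi.mul_apply]
    rw [Real.rpow_add_one hx0, Real.rpow_add_one hx1]
    ring

/-- Replacing a by s in the operator costs (a-s)(1-X)P, and the remaining term is an exact
derivative with zero boundary values. -/
lemma moment_raise {s c : ℝ} (hs : -1 < s) (hc : -1 < c) (a : ℝ) (P : ℝ[X]) :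
    moment s c (raise a c P) = (a - s) * moment s (c + 1) P := by
  have : raise a c P = raise s c P + C (a - s) * ((1 - X) * P) := by
    simp only [raise, C_add, C_sub, C_1]; ring
  rw [this, moment_add hs hc, moment_raise_self hs hc, moment_C_mul, moment_one_sub_X_mul,
    zero_add]

lemma moment_rodrigues {s c : ℝ} (hs : -1 < s) (hc : -1 < c) (a : ℝ) (m : ℕ) (P : ℝ[X]) :
    moment s c (rodrigues a c m P) = poch (a - s) m * moment s (c + m) P := by
  induction m generalizing P with
  | zero => simp [rodrigues]
  | succ m ih =>
    have : (0 : ℝ) ≤ m := m.cast_nonneg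
    rw [rodrigues, ih, moment_raise hs (by linarith), poch_succ_right]
    push_cast
    rw [add_assoc c]; ring

lemma moment_typeII {α β γ s : ℝ} (hα : -1 < α) (hβ : -1 < β) (hγ : -1 < γ) (hs : -1 < s)
    (n m : ℕ) : moment s γ (typeII α β γ n m) =
      (-1) ^ (n + m) / leadConst α β γ n m *
        (poch (α - s) n * poch (β - s) m * moment s (γ + (n + m : ℕ)) 1) := by
  have : (0 : ℝ) ≤ m := m.cast_nonneg
  rw [typeII_eq hα hβ hγ, moment_C_mul, rodriguesTypeII, moment_rodrigues hs hγ,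
    moment_rodrigues hs (by linarith)]
  have : γ + m + n = γ + (n + m : ℕ) := by push_cast; ring
  rw [this]; ring

/-- This and the next lemma are the contiguous relations of the Beta integral, read off from the
vanishing moment of `raise s c 1`. -/
lemma moment_one_succ_right {s c : ℝ} (hs : -1 < s) (hc : -1 < c) :
    (s + c + 2) * moment s (c + 1) 1 = (c + 1) * moment s c 1 := by
  have h := moment_raise_self hs hc 1
  have e : raise s c 1 = C (s + c + 2) * ((1 - X) * 1) + C (-(c + 1)) * 1 := by
    simp only [raise, derivative_one, C_add, C_1, C_neg, C_ofNat]; ring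
  rw [e, moment_add hs hc, moment_C_mul, moment_C_mul, moment_one_sub_X_mul] at h
  linarith

lemma moment_one_succ_left {s c : ℝ} (hs : -1 < s) (hc : -1 < c) :
    (s + c + 2) * moment (s + 1) c 1 = (s + 1) * moment s c 1 := by
  have h := moment_raise_self hs hc 1
  have e : raise s c 1 = C (-(s + c + 2)) * (X * 1) + C (s + 1) * 1 := by
    simp only [raise, derivative_one, C_add, C_1, C_neg, C_ofNat]; ring
  rw [e, moment_add hs hc, moment_C_mul, moment_C_mul, moment_X_mul] at h
  linarith

/-- A polynomial is determined by its moments. -/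
lemma eq_zero_of_moment_eq_zero {c : ℝ} (hc : -1 < c) {P : ℝ[X]}
    (h : ∀ k : ℕ, moment k c P = 0) : P = 0 := by
  -- Expanding one factor P in powers of x turns the weighted integral of P² into a combination of
  -- the given moments.
  have hsq : moment 0 c (P * P) = 0 := by
    have e : P * P = ∑ k ∈ Finset.range (P.natDegree + 1), C (P.coeff k) * (X ^ k * P) := by
      conv_lhs => enter [1]; rw [P.as_sum_range_C_mul_X_pow]
      rw [Finset.sum_mul]; simp only [mul_assoc]
    rw [e, moment_sum (by norm_num) hc]
    refine Finset.sum_eq_zero fun k _ => ?_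
    rw [moment_C_mul, moment_X_pow_mul, zero_add, h, mul_zero]
  have hint := intervalIntegrable_eval_mul_beta (s := 0) (by norm_num) hc (P * P)
  rw [moment, intervalIntegral.integral_of_le zero_le_one] at hsq
  rw [intervalIntegrable_iff_integrableOn_Ioc_of_le zero_le_one] at hint
  have hnn : 0 ≤ᵐ[volume.restrict (Set.Ioc (0 : ℝ) 1)]
      fun x => (P * P).eval x * (x ^ (0 : ℝ) * (1 - x) ^ c) := by
    refine (ae_restrict_iff' measurableSet_Ioc).2 (Filter.Eventually.of_forall fun x hx => ?_)
    have : 0 ≤ 1 - x := by linarith [hx.2]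
    simp only [Pi.zero_apply, eval_mul]
    exact mul_nonneg (mul_self_nonneg _)
      (mul_nonneg (Real.rpow_nonneg hx.1.le _) (Real.rpow_nonneg this _))
  have hz := (integral_eq_zero_iff_of_nonneg_ae hnn hint).1 hsq
  have hz' : ∀ᵐ x : ℝ, x ∈ Set.Ioo (0 : ℝ) 1 → P.IsRoot x := by
    filter_upwards [(ae_restrict_iff' measurableSet_Ioc).1 hz] with x hx hx1
    have := hx ⟨hx1.1, hx1.2.le⟩
    have h1 : 0 < (1 - x) ^ c := Real.rpow_pos_of_pos (by linarith [hx1.2]) _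
    simpa [h1.ne'] using this
  by_contra hP
  -- P vanishes almost everywhere on (0,1), but a nonzero polynomial has a finite, hence null, root
  -- set.
  have hfin : (P.rootSet ℝ).Finite := P.rootSet_finite ℝ
  have hnull : volume (Set.Ioo (0 : ℝ) 1) = 0 := by
    refine measure_mono_null_ae ?_ (hfin.measure_zero volume)
    filter_upwards [hz'] with x hx hx1
    exact (mem_rootSet.2 ⟨hP, by simpa using hx hx1⟩ : x ∈ P.rootSet ℝ)
  simp at hnull

lemma eq_of_moment_eq {c : ℝ} (hc : -1 < c) {P Q : ℝ[X]}
    (h : ∀ s : ℝ, 0 ≤ s → moment s c P = moment s c Q) : P = Q := by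
  refine sub_eq_zero.1 (eq_zero_of_moment_eq_zero hc fun k => ?_)
  have hk : (0 : ℝ) ≤ k := k.cast_nonneg
  have : P - Q = P + C (-1) * Q := by simp [sub_eq_add_neg]
  rw [this, moment_add (by linarith) hc, moment_C_mul, h k hk]; ring

/-! ### Orthogonality -/

lemma integrable_measure_iff {γ : ℝ} {f g : ℝ → ℝ}
    (h : ∀ x, 0 < x → x < 1 → (1 - x) ^ γ * f x = g x) :
    (Integrable f (measure γ) ↔ IntervalIntegrable g volume 0 1) ∧
      ∫ x, f x ∂measure γ = ∫ x in (0 : ℝ)..1, g x := by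
  have hm : Measurable fun x : ℝ => ENNReal.ofReal ((1 - x) ^ γ) := by fun_prop
  have hae : (fun x => (ENNReal.ofReal ((1 - x) ^ γ)).toReal • f x)
      =ᵐ[volume.restrict (Set.Ioo (0 : ℝ) 1)] g := by
    refine (ae_restrict_iff' measurableSet_Ioo).2 (Filter.Eventually.of_forall fun x hx => ?_)
    simp only
    rw [ENNReal.toReal_ofReal (Real.rpow_nonneg (by linarith [hx.2]) _), smul_eq_mul,
      h x hx.1 hx.2]
  constructor
  · rw [measure, integrable_withDensity_iff_integrable_smul' hm
      (Filter.Eventually.of_forall fun _ => ENNReal.ofReal_lt_top),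
      intervalIntegrable_iff_integrableOn_Ioo_of_le zero_le_one, ← Measure.restrict_congr_set
      Ioo_ae_eq_Icc]
    exact integrable_congr hae
  · rw [measure, integral_withDensity_eq_integral_toReal_smul hm
      (Filter.Eventually.of_forall fun _ => ENNReal.ofReal_lt_top),
      intervalIntegral.integral_of_le zero_le_one, integral_Ioc_eq_integral_Ioo,
      ← Measure.restrict_congr_set Ioo_ae_eq_Icc]
    exact integral_congr_ae hae

lemma integral_measure_eval_mul_rpow {γ a : ℝ} (hγ : -1 < γ) (ha : -1 < a) (P : ℝ[X]) (j : ℕ) :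
    Integrable (fun x => P.eval x * x ^ a * x ^ j) (measure γ) ∧
      ∫ x, P.eval x * x ^ a * x ^ j ∂measure γ = moment (a + j) γ P := by
  have hj : (0 : ℝ) ≤ j := j.cast_nonneg
  have h := integrable_measure_iff (γ := γ) (f := fun x => P.eval x * x ^ a * x ^ j)
    (g := fun x => P.eval x * (x ^ (a + j) * (1 - x) ^ γ)) fun x h0 _ => by
      rw [Real.rpow_add h0, Real.rpow_natCast]; ring
  exact ⟨h.1.2 (intervalIntegrable_eval_mul_beta (by linarith) hγ P), h.2⟩

lemma typeII_isMonicTypeII {α β γ : ℝ} (hα : -1 < α) (hβ : -1 < β) (hγ : -1 < γ) (n m : ℕ) :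
    IsMonicTypeII (measure γ) (weight α β) ![n, m] (typeII α β γ n m) where
  monic := (typeII_monic hα hβ hγ n m).1
  natDegree_eq := by simpa using (typeII_monic hα hβ hγ n m).2
  integrable a j _ := by
    fin_cases a
    · exact (integral_measure_eval_mul_rpow hγ hα _ j).1
    · exact (integral_measure_eval_mul_rpow hγ hβ _ j).1
  orthogonal a j hj := by
    have hj0 : (0 : ℝ) ≤ j := j.cast_nonneg
    fin_cases a
    · change j < n at hj
      refine (integral_measure_eval_mul_rpow hγ hα _ j).2.trans ?_
      -- At s = α + j the first Pochhammer factor is (-j)_n, zero because j < n.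
      rw [moment_typeII hα hβ hγ (by linarith), sub_add_cancel_left, poch_neg_natCast hj]
      simp
    · change j < m at hj
      refine (integral_measure_eval_mul_rpow hγ hβ _ j).2.trans ?_
      rw [moment_typeII hα hβ hγ (by linarith), sub_add_cancel_left, poch_neg_natCast hj]
      simp

/-! ### Connection formulas -/

/-- The connection formula on moments, after removing the common Pochhammer factors: s - a and s - t
are the leftover linear factors up to sign, D, D', E the leading constants, I₀ and I₁ the Beta
integrals with exponents c and c+1. -/
lemma connection_scalar {s a t c D D' E I₀ I₁ : ℝ} (hD : D ≠ 0) (hD' : D' ≠ 0) (hE : E ≠ 0)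
    (hI : (s + c + 2) * I₁ = (c + 1) * I₀) (h : D' * (a + c + 2) = D * (t + c + 2)) :
    (s - a) / D * I₁ = (s - t) / D' * I₁ + (c + 1) * E * (1 / D - 1 / D') * (I₀ / E) := by
  field_simp
  linear_combination (D' - D) * hI - I₁ * h

/-- The sign of the coefficient is that of D' - D, and the ratio D'/D = (t+c+2)/(a+c+2) is at least
1 when a ≤ t. -/
lemma connection_coeff_nonneg {a t c D D' E : ℝ} (hD : 0 < D) (hE : 0 < E)
    (hc : 0 ≤ c + 1) (ha : 0 < a + c + 2) (hat : a ≤ t)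
    (h : D' * (a + c + 2) = D * (t + c + 2)) : 0 ≤ (c + 1) * E * (1 / D - 1 / D') := by
  have : D ≤ D' := by
    refine le_of_mul_le_mul_right ?_ ha
    rw [h]
    exact mul_le_mul_of_nonneg_left (by linarith) hD.le
  have := one_div_le_one_div_of_le hD this
  exact mul_nonneg (mul_nonneg hc hE.le) (by linarith)

/-- Multiplication by x shifts s to s+1, so the left side carries the Beta integral J with
x-exponent s+1. The contiguous relations write it as a combination of I₁ and I₀. -/
lemma christoffel_scalar {s t c D D₀ D₁ I₀ I₁ J : ℝ} (hD : D ≠ 0) (hD₀ : D₀ ≠ 0) (hD₁ : D₁ ≠ 0)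
    (hs : s + c + 2 ≠ 0) (hI : (s + c + 2) * I₁ = (c + 1) * I₀)
    (hJ : (s + c + 2) * J = (s + 1) * I₀) (h : D₁ = (t + c + 2) * D) :
    J / D = (s - t) / D₁ * I₁ + D₀ * (t + 1) / D₁ * (I₀ / D₀) := by
  have h1 : (t + c + 2) * J = (s - t) * I₁ + (t + 1) * I₀ := by
    refine mul_left_cancel₀ hs ?_
    linear_combination (t + c + 2) * hJ - (s - t) * hI
  field_simp
  rw [h]
  linear_combination D * h1

variable {α β γ : ℝ}

/-- Both top-degree moments contain (α+1-s)_n (β-s)_n, which is the full Pochhammer product of the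
lower polynomial. The leftover factors are α-s and β+n-s, hence the condition α ≤ β+n. -/
lemma typeII_connection_odd (hα : -1 < α) (hβ : -1 < β) (hγ : -1 < γ) (n : ℕ) :
    ∃ b : ℝ, (α ≤ β + n → 0 ≤ b) ∧ typeII α β γ (n + 1) n =
      typeII β (α + 1) γ (n + 1) n + C b * typeII β (α + 1) γ n n := by
  have hα1 : -1 < α + 1 := by linarith
  have hD := leadConst_pos hα hβ hγ (n + 1) n
  have hD' := leadConst_pos hβ hα1 hγ (n + 1) n
  have hE := leadConst_pos hβ hα1 hγ n n
  have hn : (0 : ℝ) ≤ (n + n : ℕ) := Nat.cast_nonneg _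
  have hrel : leadConst β (α + 1) γ (n + 1) n * (α + (γ + (n + n : ℕ)) + 2) =
      leadConst α β γ (n + 1) n * (β + n + (γ + (n + n : ℕ)) + 2) := by
    rw [leadConst, leadConst, poch_succ_right, poch_succ_left]
    have : α + 1 + γ + (n + 1 + n : ℕ) + 1 = α + γ + (n + 1 + n : ℕ) + 1 + 1 := by ring
    rw [this]; push_cast; ring
  refine ⟨_, fun h => connection_coeff_nonneg hD hE (by linarith) (by linarith) h hrel, ?_⟩
  refine eq_of_moment_eq hγ fun s hs => ?_
  have hs1 : -1 < s := by linarith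
  have hc : γ + (n + 1 + n : ℕ) = γ + (n + n : ℕ) + 1 := by push_cast; ring
  have key := connection_scalar hD.ne' hD'.ne' hE.ne'
    (moment_one_succ_right (s := s) (c := γ + (n + n : ℕ)) hs1 (by linarith)) hrel
  rw [moment_add hs1 hγ, moment_C_mul, moment_typeII hα hβ hγ hs1, moment_typeII hβ hα1 hγ hs1,
    moment_typeII hβ hα1 hγ hs1, poch_succ_left, poch_succ_right, hc]
  have e1 : α + 1 - s = α - s + 1 := by ring
  have e2 : (-1 : ℝ) ^ (n + 1 + n) = -1 := Odd.neg_one_pow ⟨n, by ring⟩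
  have e3 : (-1 : ℝ) ^ (n + n) = 1 := Even.neg_one_pow ⟨n, rfl⟩
  rw [e1, e2, e3]
  linear_combination (poch (α - s + 1) n * poch (β - s) n) * key

/-- Here the leftover factors are α-s and α+1+n-s, so the coefficient is nonnegative without
comparing α and β. -/
lemma typeII_connection_even (hα : -1 < α) (hβ : -1 < β) (hγ : -1 < γ) (n : ℕ) :
    ∃ b : ℝ, 0 ≤ b ∧ typeII α β γ (n + 1) (n + 1) =
      typeII β (α + 1) γ (n + 1) (n + 1) + C b * typeII β (α + 1) γ (n + 1) n := by
  have hα1 : -1 < α + 1 := by linarith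
  have hD := leadConst_pos hα hβ hγ (n + 1) (n + 1)
  have hD' := leadConst_pos hβ hα1 hγ (n + 1) (n + 1)
  have hE := leadConst_pos hβ hα1 hγ (n + 1) n
  have hn : (0 : ℝ) ≤ (n + 1 + n : ℕ) := Nat.cast_nonneg _
  have hn' : (0 : ℝ) ≤ n := Nat.cast_nonneg _
  have hrel : leadConst β (α + 1) γ (n + 1) (n + 1) * (α + (γ + (n + 1 + n : ℕ)) + 2) =
      leadConst α β γ (n + 1) (n + 1) * (α + 1 + n + (γ + (n + 1 + n : ℕ)) + 2) := by
    rw [leadConst, leadConst, poch_succ_right (α + 1 + _ + _ + 1), poch_succ_left (α + _ + _ + 1)]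
    have : α + 1 + γ + (n + 1 + (n + 1) : ℕ) + 1 = α + γ + (n + 1 + (n + 1) : ℕ) + 1 + 1 := by
      ring
    rw [this]; push_cast; ring
  refine ⟨_, connection_coeff_nonneg hD hE (by linarith) (by linarith) (by linarith) hrel, ?_⟩
  refine eq_of_moment_eq hγ fun s hs => ?_
  have hs1 : -1 < s := by linarith
  have hc : γ + (n + 1 + (n + 1) : ℕ) = γ + (n + 1 + n : ℕ) + 1 := by push_cast; ring
  have key := connection_scalar hD.ne' hD'.ne' hE.ne'
    (moment_one_succ_right (s := s) (c := γ + (n + 1 + n : ℕ)) hs1 (by linarith)) hrel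
  rw [moment_add hs1 hγ, moment_C_mul, moment_typeII hα hβ hγ hs1, moment_typeII hβ hα1 hγ hs1,
    moment_typeII hβ hα1 hγ hs1, poch_succ_left (α - s), poch_succ_right (α + 1 - s), hc]
  have e1 : α + 1 - s = α - s + 1 := by ring
  have e2 : (-1 : ℝ) ^ (n + 1 + n) = -1 := Odd.neg_one_pow ⟨n, by ring⟩
  have e3 : (-1 : ℝ) ^ (n + 1 + (n + 1)) = 1 := Even.neg_one_pow ⟨n + 1, rfl⟩
  rw [e1, e2, e3]
  linear_combination -(poch (α - s + 1) n * poch (β - s) (n + 1)) * key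

lemma typeII_christoffel_even (hα : -1 < α) (hβ : -1 < β) (hγ : -1 < γ) (n : ℕ) :
    ∃ a : ℝ, 0 ≤ a ∧ X * typeII (α + 1) (β + 1) γ n n =
      typeII α β γ (n + 1) n + C a * typeII α β γ n n := by
  have hα1 : -1 < α + 1 := by linarith
  have hβ1 : -1 < β + 1 := by linarith
  have hD := leadConst_pos hα1 hβ1 hγ n n
  have hD₀ := leadConst_pos hα hβ hγ n n
  have hD₁ := leadConst_pos hα hβ hγ (n + 1) n
  have hn : (0 : ℝ) ≤ (n + n : ℕ) := Nat.cast_nonneg _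
  have hn' : (0 : ℝ) ≤ n := Nat.cast_nonneg _
  have hrel : leadConst α β γ (n + 1) n =
      (α + n + (γ + (n + n : ℕ)) + 2) * leadConst (α + 1) (β + 1) γ n n := by
    rw [leadConst, leadConst, poch_succ_right]
    have e1 : α + 1 + γ + (n + n : ℕ) + 1 = α + γ + (n + 1 + n : ℕ) + 1 := by push_cast; ring
    have e2 : β + 1 + γ + (n + n : ℕ) + 1 = β + γ + (n + 1 + n : ℕ) + 1 := by push_cast; ring
    rw [e1, e2]; push_cast; ring
  refine ⟨leadConst α β γ n n * (α + n + 1) / leadConst α β γ (n + 1) n,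
    div_nonneg (mul_nonneg hD₀.le (by linarith)) hD₁.le, ?_⟩
  refine eq_of_moment_eq hγ fun s hs => ?_
  have hs1 : -1 < s := by linarith
  have hc : γ + (n + 1 + n : ℕ) = γ + (n + n : ℕ) + 1 := by push_cast; ring
  have key := christoffel_scalar hD.ne' hD₀.ne' hD₁.ne'
    (show s + (γ + (n + n : ℕ)) + 2 ≠ 0 by linarith)
    (moment_one_succ_right (s := s) (c := γ + (n + n : ℕ)) hs1 (by linarith))
    (moment_one_succ_left (s := s) (c := γ + (n + n : ℕ)) hs1 (by linarith)) hrel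
  rw [moment_add hs1 hγ, moment_C_mul, moment_X_mul, moment_typeII hα1 hβ1 hγ (by linarith),
    moment_typeII hα hβ hγ hs1, moment_typeII hα hβ hγ hs1, poch_succ_right, hc]
  have e1 : α + 1 - (s + 1) = α - s := by ring
  have e1' : β + 1 - (s + 1) = β - s := by ring
  have e2 : (-1 : ℝ) ^ (n + 1 + n) = -1 := Odd.neg_one_pow ⟨n, by ring⟩
  have e3 : (-1 : ℝ) ^ (n + n) = 1 := Even.neg_one_pow ⟨n, rfl⟩
  rw [e1, e1', e2, e3]
  linear_combination (poch (α - s) n * poch (β - s) n) * key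

lemma typeII_christoffel_odd (hα : -1 < α) (hβ : -1 < β) (hγ : -1 < γ) (n : ℕ) :
    ∃ a : ℝ, 0 ≤ a ∧ X * typeII (α + 1) (β + 1) γ (n + 1) n =
      typeII α β γ (n + 1) (n + 1) + C a * typeII α β γ (n + 1) n := by
  have hα1 : -1 < α + 1 := by linarith
  have hβ1 : -1 < β + 1 := by linarith
  have hD := leadConst_pos hα1 hβ1 hγ (n + 1) n
  have hD₀ := leadConst_pos hα hβ hγ (n + 1) n
  have hD₁ := leadConst_pos hα hβ hγ (n + 1) (n + 1)
  have hn : (0 : ℝ) ≤ (n + 1 + n : ℕ) := Nat.cast_nonneg _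
  have hn' : (0 : ℝ) ≤ n := Nat.cast_nonneg _
  have hrel : leadConst α β γ (n + 1) (n + 1) =
      (β + n + (γ + (n + 1 + n : ℕ)) + 2) * leadConst (α + 1) (β + 1) γ (n + 1) n := by
    rw [leadConst, leadConst, poch_succ_right (β + _ + _ + 1)]
    have e1 : α + 1 + γ + (n + 1 + n : ℕ) + 1 = α + γ + (n + 1 + (n + 1) : ℕ) + 1 := by
      push_cast; ring
    have e2 : β + 1 + γ + (n + 1 + n : ℕ) + 1 = β + γ + (n + 1 + (n + 1) : ℕ) + 1 := by
      push_cast; ring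
    rw [e1, e2]; push_cast; ring
  refine ⟨leadConst α β γ (n + 1) n * (β + n + 1) / leadConst α β γ (n + 1) (n + 1),
    div_nonneg (mul_nonneg hD₀.le (by linarith)) hD₁.le, ?_⟩
  refine eq_of_moment_eq hγ fun s hs => ?_
  have hs1 : -1 < s := by linarith
  have hc : γ + (n + 1 + (n + 1) : ℕ) = γ + (n + 1 + n : ℕ) + 1 := by push_cast; ring
  have key := christoffel_scalar hD.ne' hD₀.ne' hD₁.ne'
    (show s + (γ + (n + 1 + n : ℕ)) + 2 ≠ 0 by linarith)
    (moment_one_succ_right (s := s) (c := γ + (n + 1 + n : ℕ)) hs1 (by linarith))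
    (moment_one_succ_left (s := s) (c := γ + (n + 1 + n : ℕ)) hs1 (by linarith)) hrel
  rw [moment_add hs1 hγ, moment_C_mul, moment_X_mul, moment_typeII hα1 hβ1 hγ (by linarith),
    moment_typeII hα hβ hγ hs1, moment_typeII hα hβ hγ hs1, poch_succ_right (β - s), hc]
  have e1 : α + 1 - (s + 1) = α - s := by ring
  have e1' : β + 1 - (s + 1) = β - s := by ring
  have e2 : (-1 : ℝ) ^ (n + 1 + n) = -1 := Odd.neg_one_pow ⟨n, by ring⟩
  have e3 : (-1 : ℝ) ^ (n + 1 + (n + 1)) = 1 := Even.neg_one_pow ⟨n + 1, rfl⟩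
  rw [e1, e1', e2, e3]
  linear_combination -(poch (α - s) (n + 1) * poch (β - s) n) * key

/-! ### The step-line sequence -/

lemma typeIISeq_even (α β γ : ℝ) (n : ℕ) : typeIISeq α β γ (n + n) = typeII α β γ n n := by
  simp only [typeIISeq, stepLine, Matrix.cons_val_zero, Matrix.cons_val_one]
  congr 1 <;> omega

lemma typeIISeq_odd (α β γ : ℝ) (n : ℕ) :
    typeIISeq α β γ (n + n + 1) = typeII α β γ (n + 1) n := by
  simp only [typeIISeq, stepLine, Matrix.cons_val_zero, Matrix.cons_val_one]
  congr 1 <;> omega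

lemma typeIISeq_even_succ (α β γ : ℝ) (n : ℕ) :
    typeIISeq α β γ (n + n + 1 + 1) = typeII α β γ (n + 1) (n + 1) := by
  rw [← typeIISeq_even]; congr 1; ring

lemma typeIISeq_zero (α β γ : ℝ) : typeIISeq α β γ 0 = 1 := by
  simp [typeIISeq, stepLine, typeII, normalization, typeIICoeff]

/-- At multi-index (1,0) the second weight imposes no condition. -/
lemma typeIISeq_one (α β β' γ : ℝ) : typeIISeq α β γ 1 = typeIISeq α β' γ 1 := by
  simp [typeIISeq, stepLine, typeII, normalization, typeIICoeff, Finset.sum_range_succ]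

lemma typeIISeq_monic (hα : -1 < α) (hβ : -1 < β) (hγ : -1 < γ) (l : ℕ) :
    (typeIISeq α β γ l).Monic ∧ (typeIISeq α β γ l).natDegree = l := by
  obtain ⟨h1, h2⟩ := typeII_monic hα hβ hγ (stepLine l 0) (stepLine l 1)
  refine ⟨h1, h2.trans ?_⟩
  simp only [stepLine, Matrix.cons_val_zero, Matrix.cons_val_one]
  omega

lemma typeIISeq_christoffel (hα : -1 < α) (hβ : -1 < β) (hγ : -1 < γ) (l : ℕ) :
    ∃ a : ℝ, 0 ≤ a ∧ X * typeIISeq (α + 1) (β + 1) γ l =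
      typeIISeq α β γ (l + 1) + C a * typeIISeq α β γ l := by
  obtain ⟨n, rfl⟩ | ⟨n, rfl⟩ := Nat.even_or_odd l
  · simp only [typeIISeq_even, typeIISeq_odd]
    exact typeII_christoffel_even hα hβ hγ n
  · rw [two_mul]
    simp only [typeIISeq_even_succ, typeIISeq_odd]
    exact typeII_christoffel_odd hα hβ hγ n

lemma typeIISeq_connection (hα : -1 < α) (hβ : -1 < β) (hγ : -1 < γ) (hαβ : α ≤ β + 1) (l : ℕ) :
    ∃ b : ℝ, (l ≠ 0 ∨ α ≤ β → 0 ≤ b) ∧ typeIISeq α β γ (l + 1) =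
      typeIISeq β (α + 1) γ (l + 1) + C b * typeIISeq β (α + 1) γ l := by
  obtain ⟨n, rfl⟩ | ⟨n, rfl⟩ := Nat.even_or_odd l
  · simp only [typeIISeq_even, typeIISeq_odd]
    obtain ⟨b, hb, h⟩ := typeII_connection_odd hα hβ hγ n
    refine ⟨b, fun hn => hb ?_, h⟩
    rcases hn with hn | hn
    · have : (1 : ℝ) ≤ n := by exact_mod_cast (by omega : 1 ≤ n)
      linarith
    · have : (0 : ℝ) ≤ n := n.cast_nonneg
      linarith
  · rw [two_mul]
    simp only [typeIISeq_even_succ, typeIISeq_odd]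
    obtain ⟨b, hb, h⟩ := typeII_connection_even hα hβ hγ n
    exact ⟨b, fun _ => hb, h⟩

/-- Since β is irrelevant in degree one, it may be taken to be α+1; a single connection step from
(α,α+1) to (α+1,α+1) then has a coefficient of the right sign. -/
lemma typeIISeq_connection_one (hα : -1 < α) (hγ : -1 < γ) :
    ∃ p : ℝ, 0 ≤ p ∧ typeIISeq α β γ 1 = typeIISeq (α + 1) (β + 1) γ 1 + C p := by
  obtain ⟨p, hp, h⟩ := typeIISeq_connection hα (show -1 < α + 1 by linarith) hγ (by linarith) 0
  refine ⟨p, hp (Or.inr (by linarith)), ?_⟩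
  rw [typeIISeq_one α β (α + 1), typeIISeq_one (α + 1) (β + 1) (α + 1)]
  simpa [typeIISeq_zero] using h

/-- Two connection steps, (α,β) to (β,α+1) to (α+1,β+1). -/
lemma typeIISeq_connection_two (hα : -1 < α) (hβ : -1 < β) (hγ : -1 < γ) (hαβ : |α - β| < 1)
    (l : ℕ) : ∃ p q : ℝ, 0 ≤ p ∧ 0 ≤ q ∧ typeIISeq α β γ (l + 2) =
      typeIISeq (α + 1) (β + 1) γ (l + 2) + C p * typeIISeq (α + 1) (β + 1) γ (l + 1) +
        C q * typeIISeq (α + 1) (β + 1) γ l := by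
  obtain ⟨h1, h2⟩ := abs_lt.1 hαβ
  obtain ⟨b, hb, e⟩ := typeIISeq_connection hα hβ hγ (by linarith) (l + 1)
  obtain ⟨b₁, hb₁, e₁⟩ := typeIISeq_connection hβ (show -1 < α + 1 by linarith) hγ (by linarith)
    (l + 1)
  obtain ⟨b₀, hb₀, e₀⟩ := typeIISeq_connection hβ (show -1 < α + 1 by linarith) hγ (by linarith) l
  -- The first step is used only at index l+1 ≠ 0, avoiding its possibly negative coefficient. The
  -- second is used at index l, possibly 0, where β ≤ α+1 suffices.
  have hb := hb (Or.inl l.succ_ne_zero)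
  have hb₁ := hb₁ (Or.inl l.succ_ne_zero)
  have hb₀ := hb₀ (Or.inr (by linarith))
  refine ⟨b₁ + b, b * b₀, by positivity, by positivity, ?_⟩
  rw [e, e₁, e₀, C_add, C_mul]
  ring

lemma typeIISeq_recurrence (hα : -1 < α) (hβ : -1 < β) (hγ : -1 < γ) (hαβ : |α - β| < 1)
    (l : ℕ) : ∃ d : ℕ → ℝ, (∀ m, 0 ≤ d m) ∧ d (l + 1) = 1 ∧ (∀ m, m + 2 < l → d m = 0) ∧
      X * typeIISeq α β γ l = ∑ m ∈ Finset.range (l + 2), C (d m) * typeIISeq α β γ m := by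
  rcases l with _ | _ | l
  · obtain ⟨a, ha, h⟩ := typeIISeq_christoffel hα hβ hγ 0
    -- The value 1 also occurs beyond l+1, in all three cases, but the sum stops at l+1.
    refine ⟨fun m => if m = 0 then a else 1, fun m => by dsimp only; split_ifs <;> simp [ha],
      by simp, fun m hm => by omega, ?_⟩
    rw [typeIISeq_zero] at h
    rw [typeIISeq_zero, h]
    simp [Finset.sum_range_succ]; ring
  · obtain ⟨a₁, ha₁, h₁⟩ := typeIISeq_christoffel hα hβ hγ 1
    obtain ⟨a₀, ha₀, h₀⟩ := typeIISeq_christoffel hα hβ hγ 0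
    obtain ⟨p, hp, h⟩ := typeIISeq_connection_one (β := β) hα hγ
    refine ⟨fun m => if m = 0 then p * a₀ else if m = 1 then a₁ + p else 1,
      fun m => by dsimp only; split_ifs <;> positivity, by simp, fun m hm => by omega, ?_⟩
    simp only [Finset.sum_range_succ, Finset.sum_range_zero]
    have : X * typeIISeq α β γ 1 = X * typeIISeq (α + 1) (β + 1) γ 1 +
        C p * (X * typeIISeq (α + 1) (β + 1) γ 0) := by rw [h, typeIISeq_zero]; ring
    rw [this, h₁, h₀]
    simp; ring
  · obtain ⟨a₂, ha₂, h₂⟩ := typeIISeq_christoffel hα hβ hγ (l + 2)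
    obtain ⟨a₁, ha₁, h₁⟩ := typeIISeq_christoffel hα hβ hγ (l + 1)
    obtain ⟨a₀, ha₀, h₀⟩ := typeIISeq_christoffel hα hβ hγ l
    obtain ⟨p, q, hp, hq, h⟩ := typeIISeq_connection_two hα hβ hγ hαβ l
    -- These are the entries of row l+2 of L U: 1, p, q from the connection, each followed by one
    -- Christoffel step with a₂, a₁, a₀.
    refine ⟨fun m => if m < l then 0 else if m = l then q * a₀ else if m = l + 1 then
      p * a₁ + q else if m = l + 2 then a₂ + p else 1,
      fun m => by dsimp only; split_ifs <;> positivity, by dsimp only; repeat rw [if_neg (by omega)],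
      fun m hm => if_pos (by omega), ?_⟩
    simp only [Finset.sum_range_succ]
    rw [Finset.sum_eq_zero fun m hm => by rw [if_pos (Finset.mem_range.1 hm), C_0, zero_mul]]
    have : X * typeIISeq α β γ (l + 2) = X * typeIISeq (α + 1) (β + 1) γ (l + 2) +
        C p * (X * typeIISeq (α + 1) (β + 1) γ (l + 1)) +
        C q * (X * typeIISeq (α + 1) (β + 1) γ l) := by rw [h]; ring
    rw [this, h₂, h₁, h₀]
    simp; ring

/-! ### The Jacobi matrix of a sequence of monic polynomials -/

section JacobiMatrix

variable {B : ℕ → ℝ[X]}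

lemma lowerInv_of_lt (S : Matrix ℕ ℕ ℝ) {l i : ℕ} (h : l < i) : lowerInv S l i = 0 := by
  rw [lowerInv, if_pos h]

/-- Solving B^{(l)} for its leading power x^l is exactly the forward substitution that defines
`lowerInv`. -/
lemma X_pow_eq_sum_lowerInv (hB : ∀ l, (B l).Monic ∧ (B l).natDegree = l) (l : ℕ) :
    X ^ l = ∑ m ∈ Finset.range (l + 1), C (lowerInv (coeffMatrix B) l m) * B m := by
  induction l using Nat.strong_induction_on with
  | _ l ih =>
    have hcoeff : (B l).coeff l = 1 := by
      have := (hB l).1.coeff_natDegree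
      rwa [(hB l).2] at this
    have h1 : B l = ∑ k ∈ Finset.range l, C ((B l).coeff k) * X ^ k + X ^ l := by
      conv_lhs => rw [(B l).as_sum_range_C_mul_X_pow, (hB l).2, Finset.sum_range_succ, hcoeff]
      simp
    have h2 : ∑ k ∈ Finset.range l, C ((B l).coeff k) * X ^ k =
        ∑ m ∈ Finset.range l, C (∑ k ∈ Finset.range l,
          (B l).coeff k * lowerInv (coeffMatrix B) k m) * B m := by
      simp only [map_sum, Finset.sum_mul]
      rw [Finset.sum_comm]
      refine Finset.sum_congr rfl fun k hk => ?_
      have hk' := Finset.mem_range.1 hk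
      rw [ih k hk', Finset.mul_sum]
      simp only [C_mul, mul_assoc]
      -- The range of m extends from m ≤ k to m < l at no cost, the inverse being lower triangular.
      refine Finset.sum_subset (Finset.range_mono hk') fun m _ hm => ?_
      rw [lowerInv_of_lt _ (by simpa using hm)]
      simp
    have h3 : ∀ m ∈ Finset.range l, C (lowerInv (coeffMatrix B) l m) * B m =
        -(C (∑ k ∈ Finset.range l, (B l).coeff k * lowerInv (coeffMatrix B) k m) * B m) := by
      intro m hm
      have hm' := Finset.mem_range.1 hm
      rw [lowerInv, if_neg (by omega), if_neg (by omega),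
        Fin.sum_univ_eq_sum_range (fun k => coeffMatrix B l k * lowerInv (coeffMatrix B) k m) l,
        C_neg, neg_mul]
      rfl
    have h4 : lowerInv (coeffMatrix B) l l = 1 := by rw [lowerInv]; simp
    rw [Finset.sum_range_succ, Finset.sum_congr rfl h3, Finset.sum_neg_distrib, ← h2, h4]
    conv_rhs => rw [C_1, one_mul]; enter [2]; rw [h1]
    ring

lemma X_mul_eq_sum_jacobiMatrix (hB : ∀ l, (B l).Monic ∧ (B l).natDegree = l) (l : ℕ) :
    X * B l = ∑ m ∈ Finset.range (l + 2), C (jacobiMatrix B l m) * B m := by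
  simp only [jacobiMatrix, map_sum, Finset.sum_mul]
  rw [Finset.sum_comm]
  conv_lhs => rw [(B l).as_sum_range_C_mul_X_pow, (hB l).2, Finset.mul_sum]
  refine Finset.sum_congr rfl fun k hk => ?_
  have hk' := Finset.mem_range.1 hk
  have : X * (C ((B l).coeff k) * X ^ k) = C ((B l).coeff k) * X ^ (k + 1) := by ring
  rw [this, X_pow_eq_sum_lowerInv hB, Finset.mul_sum]
  simp only [C_mul, mul_assoc]
  refine Finset.sum_subset (Finset.range_mono (by omega)) fun m _ hm => ?_
  rw [lowerInv_of_lt _ (by simpa using hm)]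
  simp

lemma jacobiMatrix_of_lt (B : ℕ → ℝ[X]) {l m : ℕ} (h : l + 1 < m) : jacobiMatrix B l m = 0 := by
  refine Finset.sum_eq_zero fun k hk => ?_
  have := Finset.mem_range.1 hk
  rw [lowerInv_of_lt _ (by omega), mul_zero]

lemma eq_zero_of_sum_C_mul_eq_zero (hB : ∀ l, (B l).Monic ∧ (B l).natDegree = l) {c : ℕ → ℝ}
    {N : ℕ} (h : ∑ m ∈ Finset.range N, C (c m) * B m = 0) : ∀ m < N, c m = 0 := by
  induction N with
  | zero => simp
  | succ N ih =>
    have hN : c N = 0 := by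
      have h1 := congrArg (fun P => P.coeff N) h
      simp only [finsetSum_coeff, coeff_C_mul, coeff_zero] at h1
      rw [Finset.sum_range_succ, Finset.sum_eq_zero] at h1
      · have := (hB N).1.coeff_natDegree
        rw [(hB N).2] at this
        simpa [this] using h1
      · intro m hm
        rw [coeff_eq_zero_of_natDegree_lt, mul_zero]
        rw [(hB m).2]; exact Finset.mem_range.1 hm
    rw [Finset.sum_range_succ, hN, C_0, zero_mul, add_zero] at h
    intro m hm
    rcases Nat.lt_succ_iff_lt_or_eq.1 hm with hm | rfl
    · exact ih h m hm
    · exact hN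

/-- Polynomials of distinct degrees are independent, so any expansion of x B^{(l)} gives the entries
of J; this lets the factored recurrence be compared with S Λ S⁻¹. -/
lemma jacobiMatrix_eq (hB : ∀ l, (B l).Monic ∧ (B l).natDegree = l) {l : ℕ} {d : ℕ → ℝ}
    (h : X * B l = ∑ m ∈ Finset.range (l + 2), C (d m) * B m) :
    ∀ m < l + 2, jacobiMatrix B l m = d m := by
  rw [X_mul_eq_sum_jacobiMatrix hB, ← sub_eq_zero, ← Finset.sum_sub_distrib] at h
  simp only [← sub_mul, ← C_sub] at h
  exact fun m hm => sub_eq_zero.1 (eq_zero_of_sum_C_mul_eq_zero hB h m hm)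

end JacobiMatrix

end JacobiPineiro

/-! ### Orthogonality, recurrence, band shape and nonnegativity of J -/

theorem mainTheorem2 (α β γ : ℝ) (hα : -1 < α) (hβ : -1 < β) (hγ : -1 < γ)
    (hαβ : |α - β| < 1) :
    -- the polynomials are monic type II multiple orthogonal polynomials for the given weights
    (∀ l : ℕ, JacobiPineiro.IsMonicTypeII (JacobiPineiro.measure γ) (JacobiPineiro.weight α β)
      (JacobiPineiro.stepLine l) (JacobiPineiro.typeIISeq α β γ l)) ∧
    -- the recurrence relation `x B = J B`
    (∀ l : ℕ, X * JacobiPineiro.typeIISeq α β γ l =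
      ∑ m ∈ Finset.range (l + 2),
        C (JacobiPineiro.jacobiMatrix (JacobiPineiro.typeIISeq α β γ) l m) *
          JacobiPineiro.typeIISeq α β γ m) ∧
    -- the four-diagonal shape
    (∀ l m : ℕ, l + 1 < m ∨ m + 2 < l →
      JacobiPineiro.jacobiMatrix (JacobiPineiro.typeIISeq α β γ) l m = 0) ∧
    (∀ l : ℕ, JacobiPineiro.jacobiMatrix (JacobiPineiro.typeIISeq α β γ) l (l + 1) = 1) ∧
    -- nonnegativity
    (∀ l m : ℕ, 0 ≤ JacobiPineiro.jacobiMatrix (JacobiPineiro.typeIISeq α β γ) l m) := by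
  have hB := JacobiPineiro.typeIISeq_monic hα hβ hγ
  refine ⟨fun l => JacobiPineiro.typeII_isMonicTypeII hα hβ hγ _ _,
    JacobiPineiro.X_mul_eq_sum_jacobiMatrix hB, ?_, ?_, ?_⟩
  · rintro l m (h | h)
    · exact JacobiPineiro.jacobiMatrix_of_lt _ h
    · obtain ⟨d, -, -, hd, e⟩ := JacobiPineiro.typeIISeq_recurrence hα hβ hγ hαβ l
      rw [JacobiPineiro.jacobiMatrix_eq hB e m (by omega), hd m h]
  · intro l
    obtain ⟨d, -, hd, -, e⟩ := JacobiPineiro.typeIISeq_recurrence hα hβ hγ hαβ l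
    rw [JacobiPineiro.jacobiMatrix_eq hB e _ (by omega), hd]
  · intro l m
    obtain ⟨d, hd, -, -, e⟩ := JacobiPineiro.typeIISeq_recurrence hα hβ hγ hαβ l
    rcases lt_or_ge m (l + 2) with h | h
    · rw [JacobiPineiro.jacobiMatrix_eq hB e m h]; exact hd m
    · rw [JacobiPineiro.jacobiMatrix_of_lt _ (by omega)]
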